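/- **Setting.** All spaces are real. Let $T=\bigcup_{n\ge 0}\{0,1\}^n$ be the infinite binary tree, ordered by $s\preceq t$ iff $s$ is an initial segment of $t$. Let $X_T$ be the completion of the space $c_{00}(T)$ of finitely supported functions $x\colon T\to\mathbb R$ under the norm $$\|x\|=\sup\Big\{\sum_{t\in A}|x(t)| : A\subseteq T \text{ a chain}\Big\}.$$ For $t\in T$ let $e_t\in X_T$ be the function with value $1$ at $t$ and $0$ elsewhere; for $x\in X_T$ let $x(t)$ be its $t$-th coordinate (the continuous extension of evaluation at $t$). Put $$B^+=\{x\in X_T:\|x\|\le 1,\ x(t)\ge 0\ \forall t\in T\},\qquad S^+=\{x\in B^+:\|x\|=1\}.$$ For a bounded non-empty subset $A$ of a Banach space $X$, a *slice* of $A$ is a set $\{x\in A: f(x)>\sup f(A)-\delta\}$ with $f\in X^*$ and $\delta>0$. The set $A$ is an *SCD set* if there is a countable collection $(S_n)$ of slices of $A$ such that $A\subseteq\overline{\operatorname{conv}}\{x_n\}$ for every choice of points $x_n\in S_n$. A separable Banach space is an *SCD space* if all its bounded non-empty subsets are SCD sets. A Banach space $Y$ has the *Daugavet property* if $\|\mathrm{Id}+R\|=1+\|R\|$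 for every rank one bounded operator $R\colon Y\to Y$. A *Daugavet set* is a closed convex set $A$ containing $0$ such that for every $\varepsilon>0$, every $a\in A$ with $\|a\|=1$ and every slice $S$ of $A$ there is $b\in S$ with $\|a+b\|\ge 2-\varepsilon$. **Theorem.** The family $(e_t)_{t\in T}$ is a $1$-unconditional basis of $X_T$; in particular $X_T$ is separable. Moreover: 1. The positive unit ball $B^+$ of $X_T$ is not an SCD set. 2. $B^+$ is a Daugavet set. If $x\in S^+$ is finitely supported, then for every slice $S$ of $B^+$ there is even $y\in S$ with $\|x+y\|=2$. 3. $X_T$ is not an SCD space. 4. $X_T$ contains no isomorphic copy of a non-zero Banach space with the Daugavet property. In particular, a Banach space with a ($1$-)unconditional basis need not be an SCD space, and a separable Banach space that fails to be SCD need not contain an isomorphic copy of a non-zero Banach space with the Daugavet property. -/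

import Mathlib

noncomputable section

namespace BinaryTreeSpace

/-! ### Slices, slicely countably determined sets and spaces, the Daugavet property -/

section General

variable {X : Type*} [NormedAddCommGroup X] [NormedSpace ℝ X]

/-- `S` is a slice of `A`: a non-empty set `{x ∈ A | f x > sup f(A) - δ}` with `f` in the
topological dual and `δ > 0` (used for bounded non-empty sets `A` only). -/
def IsSlice (A S : Set X) : Prop :=
  S.Nonempty ∧ ∃ (f : StrongDual ℝ X) (δ : ℝ), 0 < δ ∧ S = {x ∈ A | sSup (f '' A) - δ < f x}

/-- The family `x` is generating for `A`: `A` lies in the closed convex hull of the `x i`. -/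
def IsGenerating {ι : Type*} (A : Set X) (x : ι → X) : Prop :=
  A ⊆ closure (convexHull ℝ (Set.range x))

/-- A family of non-empty subsets `S i` of `A` is determining for `A` if every selection
`x i ∈ S i` is generating for `A`. -/
def IsDetermining {ι : Type*} (A : Set X) (S : ι → Set X) : Prop :=
  (∀ i, (S i).Nonempty ∧ S i ⊆ A) ∧ ∀ x : ι → X, (∀ i, x i ∈ S i) → IsGenerating A x

/-- `A` is a slicely countably determined set: it has a countable determining collection of
slices, enumerated here (with repetitions allowed) by `ℕ`. -/
def IsSCDSet (A : Set X) : Prop :=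
  ∃ S : ℕ → Set X, (∀ n, IsSlice A (S n)) ∧ IsDetermining A S

variable (X) in
/-- A separable space all of whose bounded non-empty subsets are slicely countably determined. -/
def IsSCDSpace : Prop :=
  TopologicalSpace.SeparableSpace X ∧
    ∀ A : Set X, Bornology.IsBounded A → A.Nonempty → IsSCDSet A

/-- A Daugavet set: a closed convex set containing `0` such that for all `ε > 0`, all norm one
`a ∈ A` and all slices `S` of `A` there is `b ∈ S` with `‖a + b‖ ≥ 2 - ε`. -/
def IsDaugavetSet (A : Set X) : Prop :=
  IsClosed A ∧ Convex ℝ A ∧ (0 : X) ∈ A ∧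
    ∀ ε : ℝ, 0 < ε → ∀ a ∈ A, ‖a‖ = 1 → ∀ S : Set X, IsSlice A S → ∃ b ∈ S, 2 - ε ≤ ‖a + b‖

variable (X) in
/-- The Daugavet property: `‖Id + T‖ = 1 + ‖T‖` for every rank one bounded operator `T`. -/
def HasDaugavetProperty : Prop :=
  ∀ T : X →L[ℝ] X, Module.finrank ℝ (LinearMap.range (T : X →ₗ[ℝ] X)) = 1 →
    ‖ContinuousLinearMap.id ℝ X + T‖ = 1 + ‖T‖

/-- The unconditional basis `b` is `K`-unconditional: changing the signs of the coefficients of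
a finite linear combination of basis vectors increases its norm by a factor of at most `K`. -/
def IsUnconditionalWith {β : Type*} (b : UnconditionalSchauderBasis β ℝ X) (K : ℝ) : Prop :=
  ∀ (s : Finset β) (a θ : β → ℝ), (∀ i, θ i = 1 ∨ θ i = -1) →
    ‖∑ i ∈ s, (θ i * a i) • b i‖ ≤ K * ‖∑ i ∈ s, a i • b i‖

end General

/-! ### The binary tree space -/

/-- The nodes of the infinite binary tree: finite sequences of zeros and ones, the root being
the empty one. The tree order is `s <+: t` (`s` is an initial segment of `t`). -/
abbrev Tree : Type := List Bool

/-- A chain of the tree. (The set of predecessors of a node is finite, so every chain is well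
ordered. The empty set is allowed; it does not affect the norm below.) -/
def TreeChain : Type := {A : Set Tree // IsChain (fun s t : Tree => s <+: t) A}

/-- The finitely supported real functions on the tree. -/
def C00 : Type := Tree →₀ ℝ

namespace C00

instance : AddCommGroup C00 := inferInstanceAs (AddCommGroup (Tree →₀ ℝ))
instance : Module ℝ C00 := inferInstanceAs (Module ℝ (Tree →₀ ℝ))
instance : CoeFun C00 (fun _ => Tree → ℝ) := ⟨fun x => Finsupp.toFun (show Tree →₀ ℝ from x)⟩

/-- The support of a finitely supported function. -/
def supp (x : C00) : Finset Tree := Finsupp.support (show Tree →₀ ℝ from x)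

/-- The function with value `1` at `t` and `0` elsewhere. -/
def single (t : Tree) : C00 := (Finsupp.single t (1 : ℝ) : Tree →₀ ℝ)

/-- The sum of `|x t|` over the nodes `t` in `A`. -/
def sumOn (x : C00) (A : Set Tree) : ℝ := ∑ t ∈ x.supp, A.indicator (fun s => |x s|) t

/-- The norm of `x`: the supremum over all chains `A` of the sum of `|x t|` over `t` in `A`. -/
instance : Norm C00 := ⟨fun x => ⨆ A : TreeChain, x.sumOn A.1⟩

theorem norm_def (x : C00) : ‖x‖ = ⨆ A : TreeChain, x.sumOn A.1 := rfl

theorem add_apply (x y : C00) (t : Tree) : (x + y) t = x t + y t :=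
  Finsupp.add_apply (show Tree →₀ ℝ from x) (show Tree →₀ ℝ from y) t

theorem smul_apply (c : ℝ) (x : C00) (t : Tree) : (c • x) t = c * x t :=
  Finsupp.smul_apply c (show Tree →₀ ℝ from x) t

theorem mem_supp (x : C00) (t : Tree) : t ∈ x.supp ↔ x t ≠ 0 :=
  Finsupp.mem_support_iff (f := (show Tree →₀ ℝ from x))

theorem ext_apply {x y : C00} (h : ∀ t, x t = y t) : x = y :=
  Finsupp.ext (f := (show Tree →₀ ℝ from x)) (g := (show Tree →₀ ℝ from y)) h

theorem zero_apply (t : Tree) : (0 : C00) t = 0 := rfl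

theorem sumOn_eq (x : C00) (A : Set Tree) (F : Finset Tree) (h : x.supp ⊆ F) :
    x.sumOn A = ∑ t ∈ F, A.indicator (fun s => |x s|) t := by
  refine Finset.sum_subset h fun t _ ht => ?_
  have : x t = 0 := by
    by_contra h0
    exact ht ((mem_supp x t).2 h0)
  by_cases hA : t ∈ A <;> simp [hA, this]

theorem sumOn_nonneg (x : C00) (A : Set Tree) : 0 ≤ x.sumOn A :=
  Finset.sum_nonneg fun _ _ => Set.indicator_nonneg (fun _ _ => abs_nonneg _) _

theorem bddAbove (x : C00) : BddAbove (Set.range fun A : TreeChain => x.sumOn A.1) := by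
  refine ⟨∑ t ∈ x.supp, |x t|, ?_⟩
  rintro _ ⟨A, rfl⟩
  exact Finset.sum_le_sum fun t _ => Set.indicator_le_self' (fun _ _ => abs_nonneg _) t

theorem sumOn_le_norm (x : C00) (A : TreeChain) : x.sumOn A.1 ≤ ‖x‖ :=
  le_ciSup (bddAbove x) A

instance : Nonempty TreeChain := ⟨⟨∅, by simp⟩⟩

theorem abs_apply_le_norm (x : C00) (t : Tree) : |x t| ≤ ‖x‖ := by
  have h : x.sumOn {t} = |x t| := by
    rw [sumOn_eq x {t} (insert t x.supp) (Finset.subset_insert _ _), Finset.sum_eq_single t]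
    · simp
    · intro s _ hs
      simp [hs]
    · simp
  rw [← h]
  exact sumOn_le_norm x ⟨{t}, by simp⟩

theorem core : NormedSpace.Core ℝ C00 where
  norm_nonneg x := le_trans (abs_nonneg _) (abs_apply_le_norm x [])
  norm_smul c x := by
    rw [norm_def, norm_def, Real.norm_eq_abs, Real.mul_iSup_of_nonneg (abs_nonneg c)]
    congr 1
    funext A
    have hs : (c • x).supp ⊆ x.supp := by
      intro t ht
      rw [mem_supp, smul_apply] at ht
      exact (mem_supp x t).2 (right_ne_zero_of_mul ht)
    rw [sumOn_eq _ _ _ hs, sumOn, Finset.mul_sum]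
    refine Finset.sum_congr rfl fun t _ => ?_
    by_cases hA : t ∈ A.1 <;> simp [hA, smul_apply, abs_mul]
  norm_triangle x y := by
    classical
    rw [norm_def (x + y)]
    refine ciSup_le fun A => ?_
    refine le_trans ?_ (add_le_add (sumOn_le_norm x A) (sumOn_le_norm y A))
    have hs : (x + y).supp ⊆ x.supp ∪ y.supp :=
      Finsupp.support_add (g₁ := (show Tree →₀ ℝ from x)) (g₂ := (show Tree →₀ ℝ from y))
    rw [sumOn_eq _ _ _ hs, sumOn_eq x _ _ Finset.subset_union_left,
      sumOn_eq y _ _ Finset.subset_union_right, ← Finset.sum_add_distrib]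
    refine Finset.sum_le_sum fun t _ => ?_
    by_cases hA : t ∈ A.1
    · simpa [hA, add_apply] using abs_add_le (x t) (y t)
    · simp [hA]
  norm_eq_zero_iff x := by
    constructor
    · intro h
      refine ext_apply fun t => ?_
      have := abs_apply_le_norm x t
      rw [h] at this
      simpa [zero_apply] using this
    · rintro rfl
      rw [norm_def]
      have : ∀ A : TreeChain, (0 : C00).sumOn A.1 = 0 := fun A =>
        Finset.sum_eq_zero fun t _ => by
          by_cases hA : t ∈ A.1 <;> simp [hA, zero_apply]
      simp [this]

instance : NormedAddCommGroup C00 := NormedAddCommGroup.ofCore core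
instance : NormedSpace ℝ C00 := NormedSpace.ofCore core

/-- The `t`-th coordinate functional on finitely supported functions. -/
def coord (t : Tree) : C00 →L[ℝ] ℝ :=
  LinearMap.mkContinuous
    { toFun := fun x => x t
      map_add' := fun x y => add_apply x y t
      map_smul' := fun c x => smul_apply c x t } 1
    (fun x => by simpa using abs_apply_le_norm x t)

end C00

/-- The binary tree space `X_T`: the completion of the finitely supported functions. -/
abbrev XT : Type := UniformSpace.Completion C00

/-- The canonical vector `e_t` of the binary tree space. -/
def e (t : Tree) : XT := ((C00.single t : C00) : XT)

/-- The `t`-th coordinate `x(t)` of `x` in the binary tree space: the continuous extension of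
the evaluation of finitely supported functions at `t`. -/
def coord (t : Tree) : StrongDual ℝ XT :=
  (C00.coord t).extend (UniformSpace.Completion.toComplL : C00 →L[ℝ] XT)

theorem coord_coe (t : Tree) (x : C00) : coord t (x : XT) = x t :=
  ContinuousLinearMap.extend_eq (C00.coord t)
    (e := (UniformSpace.Completion.toComplL : C00 →L[ℝ] XT))
    (UniformSpace.Completion.denseRange_coe)
    (UniformSpace.Completion.isUniformInducing_coe C00) x

/-- The positive cone of the binary tree space. -/
def posCone : Set XT := {x | ∀ t, 0 ≤ coord t x}

/-- The positive unit ball of the binary tree space. -/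
def posBall : Set XT := Metric.closedBall 0 1 ∩ posCone

/-- The positive unit sphere of the binary tree space. -/
def posSphere : Set XT := Metric.sphere 0 1 ∩ posCone

end BinaryTreeSpace

end

/-!
# The binary tree space

The norm of a finite combination of the vectors `e t` is the largest sum of absolute values of its
coefficients along a finite chain (`exists_isChain_norm_eq`). Hence the projections `proj F` onto
finitely many coordinates are contractions that converge pointwise to the identity, which gives the
`1`-unconditional basis and separability.

**The positive unit ball.** For a node `t` let `pathSum t x` be the sum of the coordinates of `x`
over the predecessors of `t`; this functional has norm one and, for positive `x`, increases with
`t`. The key fact is `IsSlice.exists_pathSum_eq_one`: for every slice `S` of the positive ball and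
every node `t` there are `u` above `t` and `y ∈ S` with `pathSum u y = 1`. Indeed, a slice contains
a finitely supported `z`. Adding `(1 - pathSum u z) • e u` for a node `u` above `t` and beyond the
support of `z` does not leave the positive ball, since every chain through `u` meets the support of
`z` inside the path to `u`. As the `e u` with `u` in an infinite antichain behave like the unit
vectors of `c₀`, the node `u` can be chosen such that the slicing functional is hardly decreased.
If `pathSum t x` is close to `‖x‖ = 1`, then `‖x + y‖ ≥ pathSum u (x + y)` is close to `2`, which
gives the Daugavet statements; for finitely supported `x` the value `1` is attained. Given slices
`S n`, the key fact yields inductively `y n ∈ S n` and nodes `u n` on one branch such that every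
convex combination of the `y n` has path sums equal to `1` far out on that branch. So `0` is not in
the closed convex hull of the `y n`, and the positive ball is not slicely countably determined.

**No Daugavet subspaces.** Let `J : Y → XT` be bounded and let `Y` have the Daugavet property. Then
for every finite rank operator `R`, every `z` in the unit ball and every `y` there is a `z'` in the
unit ball with `R z'` close to `R z` and `‖z' - y‖` close to `‖y‖ + 1`
(`HasDaugavetProperty.apply_mem_oppositeImage`). For slices instead of preimages of `R` this is a
reformulation of the Daugavet property; it passes to preimages because a compact convex set in a
Euclidean space is the closed convex hull of its farthest points, which have small slices as
neighbourhoods. Suppose that `J y ≈ proj F (J z)` with `‖z‖ ≤ 1`. Choosing `z'` with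
`proj F (J z') ≈ proj F (J z)`, the vector `y' = z' - y` has norm about `‖y‖ + 1`, while `J y'` is
close to `J z' - proj F (J z')`, hence to `proj F' (J z')` for some finite `F'` disjoint from `F`.
Iterating, one obtains vectors `y` of arbitrarily large norm with `‖J y‖ ≤ ‖J‖ + 1`, so `J` is not
an isomorphic embedding.
-/

noncomputable section

namespace BinaryTreeSpace

/-! ### The norm and the canonical basis -/

theorem coord_e (s t : Tree) : coord s (e t) = if s = t then 1 else 0 := by
  rw [e, coord_coe]
  change (Finsupp.single t (1 : ℝ)) s = _
  rw [Finsupp.single_apply]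
  simp only [eq_comm]

theorem coord_sum_smul_e (F : Finset Tree) (a : Tree → ℝ) (s : Tree) :
    coord s (∑ t ∈ F, a t • e t) = (F : Set Tree).indicator a s := by
  classical
  simp [map_sum, coord_e, Set.indicator_apply]

theorem C00.eq_sum_single (x : C00) : x = ∑ t ∈ x.supp, x t • C00.single t := by
  classical
  have h := Finsupp.sum_single (show Tree →₀ ℝ from x)
  conv_lhs => rw [show x = (show Tree →₀ ℝ from x) from rfl, ← h]
  unfold Finsupp.sum
  refine Finset.sum_congr rfl fun t _ => ?_
  change Finsupp.single t (x t) = x t • Finsupp.single t (1 : ℝ)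
  simp

theorem coe_eq_sum (x : C00) : (x : XT) = ∑ t ∈ x.supp, x t • e t := by
  conv_lhs => rw [C00.eq_sum_single x]
  change UniformSpace.Completion.toComplL (𝕜 := ℝ) (∑ t ∈ x.supp, x t • C00.single t) = _
  rw [map_sum]
  simp only [map_smul]
  rfl

/-- The sums of `|x t|` over finite chains are bounded by the norm, in the completion as well. -/
theorem sum_abs_coord_le_norm {G : Finset Tree}
    (hG : IsChain (fun s t : Tree => s <+: t) (G : Set Tree)) (x : XT) :
    ∑ t ∈ G, |coord t x| ≤ ‖x‖ := by
  classical
  induction x using UniformSpace.Completion.induction_on with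
  | hp => exact isClosed_le (by fun_prop) continuous_norm
  | ih x =>
    simp only [coord_coe, UniformSpace.Completion.norm_coe]
    refine le_trans (le_of_eq ?_) (C00.sumOn_le_norm x ⟨G, hG⟩)
    rw [C00.sumOn_eq x _ (x.supp ∪ G) Finset.subset_union_left, Finset.sum_indicator_eq_sum_filter]
    refine Finset.sum_congr ?_ fun _ _ => rfl
    ext t
    simp

/-- The norm of a finite combination of the `e t` is attained at a finite chain. -/
theorem exists_isChain_norm_eq (F : Finset Tree) (a : Tree → ℝ) :
    ∃ G ⊆ F, IsChain (fun s t : Tree => s <+: t) (G : Set Tree) ∧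
      ‖∑ t ∈ F, a t • e t‖ = ∑ t ∈ G, |a t| := by
  classical
  obtain ⟨G, hG, hmax⟩ := (F.powerset.filter fun G : Finset Tree =>
    IsChain (fun s t : Tree => s <+: t) (G : Set Tree)).exists_max_image
      (fun G => ∑ t ∈ G, |a t|) ⟨∅, by simp⟩
  simp only [Finset.mem_filter, Finset.mem_powerset] at hG hmax
  refine ⟨G, hG.1, hG.2, le_antisymm ?_ ?_⟩
  · have h : ∑ t ∈ F, a t • e t = ((∑ t ∈ F, a t • C00.single t : C00) : XT) := by
      change _ = UniformSpace.Completion.toComplL (𝕜 := ℝ) (∑ t ∈ F, a t • C00.single t)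
      rw [map_sum]
      simp only [map_smul]
      rfl
    have hx : ∀ s, (∑ t ∈ F, a t • C00.single t : C00) s = (F : Set Tree).indicator a s := by
      intro s
      rw [← coord_coe, ← h, coord_sum_smul_e]
    rw [h, UniformSpace.Completion.norm_coe, C00.norm_def]
    refine ciSup_le fun A => ?_
    rw [C00.sumOn_eq _ _ F, Finset.sum_indicator_eq_sum_filter]
    · refine le_trans (le_of_eq ?_) (hmax (F.filter (· ∈ A.1))
        ⟨Finset.filter_subset _ _, A.2.mono fun t ht => (Finset.mem_filter.1 ht).2⟩)
      refine Finset.sum_congr rfl fun t ht => ?_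
      simp [hx, (Finset.mem_filter.1 ht).1]
    · intro t ht
      rw [C00.mem_supp, hx] at ht
      simpa using Set.mem_of_indicator_ne_zero ht
  · refine le_trans (le_of_eq ?_) (sum_abs_coord_le_norm hG.2 _)
    refine Finset.sum_congr rfl fun t ht => ?_
    rw [coord_sum_smul_e, Set.indicator_of_mem (Finset.mem_coe.2 (hG.1 ht))]

theorem norm_sum_le_norm {F : Finset Tree} {a : Tree → ℝ} {x : XT}
    (h : ∀ t ∈ F, |a t| ≤ |coord t x|) : ‖∑ t ∈ F, a t • e t‖ ≤ ‖x‖ := by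
  obtain ⟨G, hGF, hG, h'⟩ := exists_isChain_norm_eq F a
  rw [h']
  exact (Finset.sum_le_sum fun t ht => h t (hGF ht)).trans (sum_abs_coord_le_norm hG x)

/-- The projection onto the span of the `e t` with `t ∈ F`. -/
def proj (F : Finset Tree) : XT →L[ℝ] XT := ∑ t ∈ F, (coord t).smulRight (e t)

theorem proj_apply (F : Finset Tree) (x : XT) : proj F x = ∑ t ∈ F, coord t x • e t := by
  simp [proj]

theorem norm_proj_le (F : Finset Tree) (x : XT) : ‖proj F x‖ ≤ ‖x‖ := by
  rw [proj_apply]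
  exact norm_sum_le_norm fun _ _ => le_rfl

theorem coord_proj (F : Finset Tree) (x : XT) (t : Tree) :
    coord t (proj F x) = (F : Set Tree).indicator (fun s => coord s x) t := by
  rw [proj_apply, coord_sum_smul_e]

theorem proj_coe {F : Finset Tree} {x : C00} (h : x.supp ⊆ F) : proj F (x : XT) = x := by
  rw [proj_apply]
  simp only [coord_coe]
  refine Eq.trans (Eq.symm ?_) (coe_eq_sum x).symm
  refine Finset.sum_subset h fun t _ ht => ?_
  have : x t = 0 := by
    by_contra h0
    exact ht ((C00.mem_supp x t).2 h0)
  simp [this]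

theorem exists_norm_proj_sub_lt (x : XT) {ε : ℝ} (hε : 0 < ε) :
    ∃ F₀ : Finset Tree, ∀ F, F₀ ⊆ F → ‖proj F x - x‖ < ε := by
  obtain ⟨y, hy⟩ := Metric.mem_closure_range_iff.1
    (UniformSpace.Completion.denseRange_coe (α := C00) x) (ε / 2) (by positivity)
  rw [dist_eq_norm] at hy
  refine ⟨y.supp, fun F hF => ?_⟩
  calc ‖proj F x - x‖ = ‖proj F (x - y) - (x - y)‖ := by
        rw [map_sub, proj_coe hF]; congr 1; abel
    _ ≤ ‖proj F (x - y)‖ + ‖x - y‖ := norm_sub_le _ _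
    _ ≤ ‖x - y‖ + ‖x - y‖ := by gcongr; exact norm_proj_le _ _
    _ < ε := by linarith

theorem hasSum_coord_smul_e (x : XT) : HasSum (fun t => coord t x • e t) x := by
  rw [HasSum, SummationFilter.unconditional_filter, Metric.tendsto_atTop]
  intro ε hε
  obtain ⟨F₀, h⟩ := exists_norm_proj_sub_lt x hε
  refine ⟨F₀, fun F hF => ?_⟩
  rw [dist_eq_norm, ← proj_apply]
  exact h F hF

/-- The canonical vectors as an unconditional basis. -/
def canonicalBasis : UnconditionalSchauderBasis Tree ℝ XT where
  basis := e
  coord := coord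
  ortho s t := by
    rcases eq_or_ne s t with rfl | h
    · simp [coord_e, Pi.single, Function.update]
    · simp [coord_e, Pi.single, Function.update, h]
  expansion := hasSum_coord_smul_e

theorem isUnconditionalWith_canonicalBasis : IsUnconditionalWith canonicalBasis 1 := by
  intro s a θ hθ
  rw [one_mul]
  refine norm_sum_le_norm (a := fun i => θ i * a i) fun t ht => ?_
  change _ ≤ |coord t (∑ i ∈ s, a i • e i)|
  rw [coord_sum_smul_e, Set.indicator_of_mem (Finset.mem_coe.2 ht), abs_mul]
  rcases hθ t with h | h <;> simp [h]

theorem separableSpace : TopologicalSpace.SeparableSpace XT := by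
  rw [← TopologicalSpace.isSeparable_univ_iff]
  refine ((Set.countable_range e).isSeparable.span (R := ℝ)).closure.mono fun x _ => ?_
  refine mem_closure_of_tendsto (hasSum_coord_smul_e x) (Filter.Eventually.of_forall fun F => ?_)
  exact Submodule.sum_mem _ fun t _ =>
    Submodule.smul_mem _ _ (Submodule.subset_span ⟨t, rfl⟩)

/-! ### Sums along the path to a node -/

/-- The sum of the coordinates of `x` over the predecessors of the node `t`, including `t`. -/
def pathSum (t : Tree) : StrongDual ℝ XT := ∑ s ∈ t.inits.toFinset, coord s

theorem pathSum_apply (t : Tree) (x : XT) : pathSum t x = ∑ s ∈ t.inits.toFinset, coord s x := by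
  simp [pathSum]

theorem mem_inits_toFinset {s t : Tree} : s ∈ t.inits.toFinset ↔ s <+: t := by
  simp

theorem isChain_inits (t : Tree) :
    IsChain (fun s t : Tree => s <+: t) (t.inits.toFinset : Set Tree) := by
  intro s hs r hr _
  simp only [List.coe_toFinset, List.mem_inits, Set.mem_ofPred_eq] at hs hr
  exact List.prefix_or_prefix_of_prefix hs hr

theorem pathSum_le_norm (t : Tree) (x : XT) : pathSum t x ≤ ‖x‖ := by
  rw [pathSum_apply]
  exact (Finset.sum_le_sum fun s _ => le_abs_self _).trans
    (sum_abs_coord_le_norm (isChain_inits t) x)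

theorem pathSum_mono {x : XT} (hx : x ∈ posCone) {s t : Tree} (h : s <+: t) :
    pathSum s x ≤ pathSum t x := by
  rw [pathSum_apply, pathSum_apply]
  refine Finset.sum_le_sum_of_subset_of_nonneg (fun r hr => ?_) fun r _ _ => hx r
  rw [mem_inits_toFinset] at hr ⊢
  exact hr.trans h

theorem exists_subset_inits {G : Finset Tree}
    (hG : IsChain (fun s t : Tree => s <+: t) (G : Set Tree)) : ∃ t : Tree, ∀ s ∈ G, s <+: t := by
  rcases G.eq_empty_or_nonempty with rfl | hne
  · exact ⟨[], by simp⟩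
  · obtain ⟨t, ht, hmax⟩ := G.exists_max_image List.length hne
    refine ⟨t, fun s hs => ?_⟩
    by_cases hst : s = t
    · exact hst ▸ List.prefix_rfl
    · rcases hG (Finset.mem_coe.2 hs) (Finset.mem_coe.2 ht) hst with h | h
      · exact h
      · exact (h.eq_of_length (le_antisymm h.length_le (hmax s hs))) ▸ List.prefix_rfl

theorem proj_mem_posCone {x : XT} (hx : x ∈ posCone) (F : Finset Tree) : proj F x ∈ posCone := by
  intro t
  rw [coord_proj]
  exact Set.indicator_nonneg (fun s _ => hx s) t

/-- The norm of `proj F x`, for positive `x`, is recovered along a single path. -/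
theorem exists_norm_proj_le_pathSum {x : XT} (hx : x ∈ posCone) (F : Finset Tree) :
    ∃ t, ‖proj F x‖ ≤ pathSum t x := by
  obtain ⟨G, -, hG, h⟩ := exists_isChain_norm_eq F fun t => coord t x
  obtain ⟨t, ht⟩ := exists_subset_inits hG
  refine ⟨t, ?_⟩
  rw [proj_apply, h, pathSum_apply]
  simp only [abs_of_nonneg (hx _)]
  exact Finset.sum_le_sum_of_subset_of_nonneg (fun s hs => mem_inits_toFinset.2 (ht s hs))
    fun s _ _ => hx s

theorem isClosed_posBall : IsClosed posBall := by
  refine Metric.isClosed_closedBall.inter ?_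
  rw [posCone, Set.ofPred_forall]
  exact isClosed_iInter fun t => isClosed_le continuous_const (coord t).continuous

theorem convex_posBall : Convex ℝ posBall := by
  refine (convex_closedBall 0 1).inter fun x hx y hy a b ha hb _ t => ?_
  simp only [map_add, map_smul, smul_eq_mul]
  exact add_nonneg (mul_nonneg ha (hx t)) (mul_nonneg hb (hy t))

theorem zero_mem_posBall : (0 : XT) ∈ posBall := by
  simp [posBall, posCone]

theorem norm_le_one_of_mem_posBall {x : XT} (hx : x ∈ posBall) : ‖x‖ ≤ 1 := by
  simpa using hx.1

/-! ### Slices of the positive unit ball -/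

/-- Above every node there are basis vectors at which a given functional is almost non-negative:
the vectors `e t`, for `t` in an antichain, span an isometric copy of `c₀`. -/
theorem exists_neg_lt_apply_e (f : StrongDual ℝ XT) (t : Tree) {η : ℝ} (hη : 0 < η) :
    ∃ u, t <+: u ∧ -η < f (e u) := by
  classical
  by_contra! H
  let u : ℕ → Tree := fun n => t ++ (List.replicate n true ++ [false])
  have hpre : ∀ m n, u m <+: u n → m = n := by
    intro m n h
    rw [List.prefix_append_right_inj] at h
    induction m generalizing n with
    | zero =>
      cases n with
      | zero => rfl
      | succ n => simp [List.replicate_succ] at h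
    | succ m ih =>
      cases n with
      | zero => simp [List.replicate_succ] at h
      | succ n =>
        simp only [List.replicate_succ, List.cons_append, List.cons_prefix_cons, true_and] at h
        rw [ih n h]
  have hinj : Function.Injective u := fun m n h => hpre m n (h ▸ List.prefix_rfl)
  have hnorm : ∀ N : ℕ, ‖∑ s ∈ (Finset.range N).image u, (1 : ℝ) • e s‖ ≤ 1 := by
    intro N
    obtain ⟨G, hGF, hG, h⟩ := exists_isChain_norm_eq ((Finset.range N).image u) fun _ => 1
    rw [h]
    have : G.card ≤ 1 := by
      refine Finset.card_le_one.2 fun a ha b hb => ?_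
      obtain ⟨m, -, rfl⟩ := Finset.mem_image.1 (hGF ha)
      obtain ⟨n, -, rfl⟩ := Finset.mem_image.1 (hGF hb)
      by_contra hne
      rcases hG (Finset.mem_coe.2 ha) (Finset.mem_coe.2 hb) hne with h | h
      · exact hne (hpre _ _ h ▸ rfl)
      · exact hne (hpre _ _ h ▸ rfl)
    simpa using this
  obtain ⟨N, hN⟩ := exists_nat_gt (‖f‖ / η)
  have h1 : f (∑ s ∈ (Finset.range N).image u, (1 : ℝ) • e s) ≤ -(N * η) := by
    rw [Finset.sum_image hinj.injOn, map_sum]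
    refine (Finset.sum_le_sum (g := fun _ => -η) fun n _ => ?_).trans (by simp)
    rw [one_smul]
    exact H (u n) (List.prefix_append _ _)
  have h2 := (abs_le.1 (f.le_opNorm_of_le (hnorm N))).1
  rw [div_lt_iff₀ hη] at hN
  linarith

theorem exists_forall_length_lt_prefix (F : Finset Tree) (t : Tree) :
    ∃ u, t <+: u ∧ ∀ s ∈ F, s.length < u.length := by
  refine ⟨t ++ List.replicate (F.sup List.length + 1) true, List.prefix_append _ _, fun s hs => ?_⟩
  have := Finset.le_sup (f := List.length) hs
  rw [List.length_append, List.length_replicate]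
  omega

/-- A positive vector `x` supported by `F` can be topped up at a node `u` beyond `F`, so that its
path sum at `u` becomes `1`, without leaving the positive unit ball. -/
theorem proj_add_smul_e_mem_posBall {x : XT} (hx : x ∈ posBall) {F : Finset Tree} {u : Tree}
    (hu : ∀ s ∈ F, s.length < u.length) :
    proj F x + (1 - pathSum u (proj F x)) • e u ∈ posBall ∧
      pathSum u (proj F x + (1 - pathSum u (proj F x)) • e u) = 1 := by
  classical
  have huF : u ∉ F := fun h => lt_irrefl _ (hu u h)
  have hp := proj_mem_posCone hx.2 F
  have hα : pathSum u (proj F x) ≤ 1 :=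
    (pathSum_le_norm _ _).trans ((norm_proj_le F x).trans (norm_le_one_of_mem_posBall hx))
  set α := pathSum u (proj F x) with hαdef
  have hαsum : ∀ H ⊆ F, (∀ s ∈ H, s <+: u) → ∑ s ∈ H, coord s x ≤ α := by
    intro H hHF hH
    rw [hαdef, pathSum_apply]
    refine le_trans (le_of_eq ?_) (Finset.sum_le_sum_of_subset_of_nonneg
      (fun s hs => mem_inits_toFinset.2 (hH s hs)) fun s _ _ => hp s)
    refine Finset.sum_congr rfl fun s hs => ?_
    rw [coord_proj, Set.indicator_of_mem (Finset.mem_coe.2 (hHF hs))]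
  refine ⟨⟨?_, fun t => ?_⟩, ?_⟩
  · rw [mem_closedBall_zero_iff]
    have hrep : proj F x + (1 - α) • e u =
        ∑ t ∈ insert u F, (if t = u then 1 - α else coord t x) • e t := by
      rw [Finset.sum_insert huF, if_pos rfl, add_comm, proj_apply]
      congr 1
      refine Finset.sum_congr rfl fun t ht => ?_
      rw [if_neg (ne_of_mem_of_not_mem ht huF)]
    obtain ⟨G, hGF, hG, h⟩ := exists_isChain_norm_eq (insert u F)
      fun t => if t = u then 1 - α else coord t x
    rw [hrep, h]
    have hsum : ∀ H : Finset Tree, u ∉ H →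
        ∑ t ∈ H, |if t = u then 1 - α else coord t x| = ∑ t ∈ H, coord t x := by
      intro H hH
      refine Finset.sum_congr rfl fun t ht => ?_
      rw [if_neg (ne_of_mem_of_not_mem ht hH), abs_of_nonneg (hx.2 t)]
    by_cases huG : u ∈ G
    · rw [← Finset.add_sum_erase _ _ huG, hsum _ (Finset.notMem_erase _ _), if_pos rfl,
        abs_of_nonneg (by linarith)]
      have := hαsum (G.erase u) (fun s hs => ?_) fun s hs => ?_
      · linarith
      · rw [Finset.mem_erase] at hs
        exact (Finset.mem_insert.1 (hGF hs.2)).resolve_left hs.1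
      · rw [Finset.mem_erase] at hs
        have hsF := (Finset.mem_insert.1 (hGF hs.2)).resolve_left hs.1
        rcases hG (Finset.mem_coe.2 hs.2) (Finset.mem_coe.2 huG) hs.1 with h | h
        · exact h
        · exact absurd h.length_le (hu s hsF).not_ge
    · rw [hsum G huG]
      calc ∑ t ∈ G, coord t x = ∑ t ∈ G, |coord t x| :=
            Finset.sum_congr rfl fun t _ => (abs_of_nonneg (hx.2 t)).symm
        _ ≤ ‖x‖ := sum_abs_coord_le_norm hG x
        _ ≤ 1 := norm_le_one_of_mem_posBall hx
  · rw [map_add, map_smul, coord_e, smul_eq_mul]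
    refine add_nonneg (hp t) (mul_nonneg (by linarith) ?_)
    split_ifs <;> norm_num
  · have : pathSum u (e u) = 1 := by
      rw [pathSum_apply]
      simp [coord_e]
    rw [map_add, map_smul, this, ← hαdef]
    simp

/-- Every slice of the positive unit ball contains, for every node `t`, a vector whose
coordinates along some path through `t` add up to `1`. -/
theorem IsSlice.exists_pathSum_eq_one {S : Set XT} (hS : IsSlice posBall S) (t : Tree) :
    ∃ u, t <+: u ∧ ∃ y ∈ S, pathSum u y = 1 := by
  obtain ⟨⟨z, hz⟩, f, δ, -, rfl⟩ := hS
  set c := sSup (f '' posBall) - δ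
  obtain ⟨hzB, hfz⟩ : z ∈ posBall ∧ c < f z := hz
  obtain ⟨F, hF⟩ : ∃ F, c < f (proj F z) := by
    have h : Filter.Tendsto (fun F => f (proj F z)) Filter.atTop (nhds (f z)) := by
      simp only [proj_apply]
      exact (f.continuous.tendsto z).comp (hasSum_coord_smul_e z)
    exact (h.eventually_const_lt hfz).exists
  obtain ⟨t', htt', ht'⟩ := exists_forall_length_lt_prefix F t
  obtain ⟨u, htu, hfu⟩ := exists_neg_lt_apply_e f t' (half_pos (sub_pos.2 hF))
  obtain ⟨hmem, hsum⟩ := proj_add_smul_e_mem_posBall hzB (F := F) (u := u)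
    fun s hs => (ht' s hs).trans_le htu.length_le
  refine ⟨u, htt'.trans htu, _, ⟨hmem, ?_⟩, hsum⟩
  have hp := proj_mem_posCone hzB.2 F
  have h0 : 0 ≤ pathSum u (proj F z) := by
    rw [pathSum_apply]
    exact Finset.sum_nonneg fun s _ => hp s
  have h1 : pathSum u (proj F z) ≤ 1 :=
    (pathSum_le_norm _ _).trans ((norm_proj_le F z).trans (norm_le_one_of_mem_posBall hzB))
  have h2 : (1 - pathSum u (proj F z)) * -((f (proj F z) - c) / 2) ≤
      (1 - pathSum u (proj F z)) * f (e u) :=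
    mul_le_mul_of_nonneg_left hfu.le (by linarith)
  change c < f (proj F z + (1 - pathSum u (proj F z)) • e u)
  rw [map_add, map_smul, smul_eq_mul]
  nlinarith

theorem posBall_not_isSCDSet : ¬ IsSCDSet posBall := by
  rintro ⟨S, hS, hSd, hdet⟩
  choose! next hnext y hyS hy using fun n => (hS n).exists_pathSum_eq_one
  -- The nodes `u n` lie on one branch, and `y n (u n) ∈ S n` sums up to `1` along the path to
  -- `u (n + 1)`.
  let u : ℕ → Tree := fun n => Nat.rec [] next n
  have hu : ∀ m n, m ≤ n → u m <+: u n := fun m n h =>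
    Nat.le_induction List.prefix_rfl (fun n _ ih => ih.trans (hnext n (u n))) n h
  have hmem : ∀ n, y n (u n) ∈ posBall := fun n => (hSd n).2 (hyS n _)
  have hnorm : convexHull ℝ (Set.range fun n => y n (u n)) ⊆ {x | 1 ≤ ‖x‖} := by
    suffices h : convexHull ℝ (Set.range fun n => y n (u n)) ⊆
        {x | ∃ N, ∀ n ≥ N, 1 ≤ pathSum (u n) x} by
      intro x hx
      obtain ⟨N, hN⟩ := h hx
      exact (hN N le_rfl).trans (pathSum_le_norm _ _)
    refine convexHull_min ?_ ?_
    · rintro _ ⟨n, rfl⟩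
      refine ⟨n + 1, fun m hm => ?_⟩
      exact (hy n (u n)).symm.le.trans (pathSum_mono (hmem n).2 (hu (n + 1) m hm))
    · rintro x ⟨N, hN⟩ z ⟨M, hM⟩ a b ha hb hab
      refine ⟨max N M, fun n hn => ?_⟩
      rw [map_add, map_smul, map_smul, smul_eq_mul, smul_eq_mul]
      have h1 := hN n (le_trans (le_max_left _ _) hn)
      have h2 := hM n (le_trans (le_max_right _ _) hn)
      nlinarith
  have h0 := closure_minimal hnorm (isClosed_le continuous_const continuous_norm)
    (hdet (fun n => y n (u n)) (fun n => hyS n _) zero_mem_posBall)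
  simp only [Set.mem_ofPred_eq, norm_zero] at h0
  linarith

theorem IsSlice.exists_pathSum_add_one_le_norm {S : Set XT} (hS : IsSlice posBall S) {x : XT}
    (hx : x ∈ posCone) (t : Tree) : ∃ y ∈ S, pathSum t x + 1 ≤ ‖x + y‖ := by
  obtain ⟨u, htu, y, hyS, hy⟩ := hS.exists_pathSum_eq_one t
  refine ⟨y, hyS, ?_⟩
  calc pathSum t x + 1 ≤ pathSum u x + pathSum u y := by
        rw [hy]; gcongr; exact pathSum_mono hx htu
    _ = pathSum u (x + y) := (map_add _ _ _).symm
    _ ≤ ‖x + y‖ := pathSum_le_norm _ _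

theorem isDaugavetSet_posBall : IsDaugavetSet posBall := by
  refine ⟨isClosed_posBall, convex_posBall, zero_mem_posBall, fun ε hε a ha ha1 S hS => ?_⟩
  obtain ⟨F, hF⟩ := exists_norm_proj_sub_lt a hε
  obtain ⟨t, ht⟩ := exists_norm_proj_le_pathSum ha.2 F
  obtain ⟨b, hb, h⟩ := hS.exists_pathSum_add_one_le_norm ha.2 t
  refine ⟨b, hb, ?_⟩
  have h1 := hF F subset_rfl
  have h2 := norm_sub_norm_le a (proj F a)
  rw [norm_sub_rev] at h2
  linarith

theorem exists_norm_add_eq_two {x : XT} (hx : x ∈ posSphere) (hfin : {t | coord t x ≠ 0}.Finite)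
    {S : Set XT} (hS : IsSlice posBall S) : ∃ y ∈ S, ‖x + y‖ = 2 := by
  have hx1 : ‖x‖ = 1 := by simpa using hx.1
  have hproj : proj hfin.toFinset x = x := by
    rw [proj_apply]
    refine (hasSum_sum_of_ne_finset_zero fun t ht => ?_).unique (hasSum_coord_smul_e x)
    have : coord t x = 0 := by simpa using ht
    simp [this]
  obtain ⟨t, ht⟩ := exists_norm_proj_le_pathSum hx.2 hfin.toFinset
  obtain ⟨y, hy, h⟩ := hS.exists_pathSum_add_one_le_norm hx.2 t
  rw [hproj] at ht
  have hyB : y ∈ posBall := by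
    obtain ⟨-, f, δ, -, rfl⟩ := hS
    exact hy.1
  refine ⟨y, hy, le_antisymm ?_ (by linarith)⟩
  linarith [norm_add_le x y, norm_le_one_of_mem_posBall hyB]

theorem not_isSCDSpace : ¬ IsSCDSpace XT := fun h => posBall_not_isSCDSet <|
  h.2 _ (Metric.isBounded_closedBall.subset Set.inter_subset_left) ⟨0, zero_mem_posBall⟩

/-! ### Spaces with the Daugavet property -/

section Daugavet

variable {Y : Type*} [NormedAddCommGroup Y] [NormedSpace ℝ Y]

theorem HasDaugavetProperty.norm_id_add_smulRight (hY : HasDaugavetProperty Y)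
    {f : StrongDual ℝ Y} (hf : f ≠ 0) {y : Y} (hy : y ≠ 0) :
    ‖ContinuousLinearMap.id ℝ Y + f.smulRight y‖ = 1 + ‖f‖ * ‖y‖ := by
  rw [hY, ContinuousLinearMap.norm_smulRight_apply]
  have : LinearMap.range ((f.smulRight y : Y →L[ℝ] Y) : Y →ₗ[ℝ] Y) = Submodule.span ℝ {y} := by
    apply le_antisymm
    · rintro _ ⟨x, rfl⟩
      exact Submodule.smul_mem _ _ (Submodule.mem_span_singleton_self y)
    · obtain ⟨x, hx⟩ : ∃ x, f x ≠ 0 := by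
        by_contra! h
        exact hf (ContinuousLinearMap.ext h)
      rw [Submodule.span_singleton_le_iff_mem]
      exact ⟨(f x)⁻¹ • x, by simp [hx]⟩
  rw [this, finrank_span_singleton hy]

/-- In a space with the Daugavet property every slice of the unit ball contains a point which is
almost diametrically opposite to a given vector `y`. -/
theorem HasDaugavetProperty.exists_mem_slice [Nontrivial Y] (hY : HasDaugavetProperty Y)
    (f : StrongDual ℝ Y) (y : Y) {ε : ℝ} (hε : 0 < ε) :
    ∃ z : Y, ‖z‖ ≤ 1 ∧ ‖f‖ - ε ≤ f z ∧ ‖y‖ + 1 - ε ≤ ‖z - y‖ := by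
  -- Reduction to non-zero `f` and `y`.
  wlog hy : y ≠ 0 generalizing y ε
  · rw [not_not] at hy
    obtain ⟨v, hv⟩ := exists_ne (0 : Y)
    have hv0 : 0 < ‖v‖ := norm_pos_iff.2 hv
    obtain ⟨z, hz, hfz, hzv⟩ := this ((ε / 4 / ‖v‖) • v) (half_pos hε)
      (smul_ne_zero (by positivity) hv)
    have hn : ‖(ε / 4 / ‖v‖) • v‖ = ε / 4 := by
      rw [norm_smul, Real.norm_of_nonneg (by positivity)]
      field_simp
    refine ⟨z, hz, by linarith, ?_⟩
    rw [hy, norm_zero, sub_zero]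
    have := norm_sub_le z ((ε / 4 / ‖v‖) • v)
    linarith
  wlog hf : f ≠ 0 generalizing f
  · rw [not_not] at hf
    obtain ⟨v, hv⟩ := exists_ne (0 : Y)
    obtain ⟨g, hg, -⟩ := exists_dual_vector ℝ v (norm_ne_zero_iff.2 hv)
    have hg0 : g ≠ 0 := by
      rintro rfl
      simp at hg
    obtain ⟨z, hz, -, hzy⟩ := this g hg0
    exact ⟨z, hz, by simp [hf, hε.le], hzy⟩
  have hf0 : 0 < ‖f‖ := norm_pos_iff.2 hf
  have hy0 : 0 < ‖y‖ := norm_pos_iff.2 hy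
  -- The functional is normalized to `g`, of norm one.
  set g : StrongDual ℝ Y := ‖f‖⁻¹ • f with hg
  have hg1 : ‖g‖ = 1 := by
    rw [hg, norm_smul, norm_inv, norm_norm, inv_mul_cancel₀ hf0.ne']
  have hg0 : g ≠ 0 := norm_pos_iff.1 (by rw [hg1]; norm_num)
  obtain ⟨η, hη, hη1, hη2⟩ : ∃ η : ℝ, 0 < η ∧ η * 2 ≤ ε ∧ η * ‖f‖ ≤ ε * ‖y‖ :=
    ⟨min (ε / 2) (ε * ‖y‖ / ‖f‖), by positivity,
      (mul_le_mul_of_nonneg_right (min_le_left _ _) (by norm_num)).trans (by linarith),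
      (mul_le_mul_of_nonneg_right (min_le_right _ _) hf0.le).trans
        (by rw [div_mul_cancel₀ _ hf0.ne'])⟩
  have hD := hY.norm_id_add_smulRight hg0 (neg_ne_zero.2 hy)
  rw [hg1, one_mul, norm_neg] at hD
  obtain ⟨z, hz, hzn⟩ : ∃ z : Y, ‖z‖ ≤ 1 ∧ 1 + ‖y‖ - η < ‖z - g z • y‖ := by
    obtain ⟨z, hz, h⟩ := ContinuousLinearMap.exists_lt_apply_of_lt_opNorm
      (ContinuousLinearMap.id ℝ Y + g.smulRight (-y)) (r := 1 + ‖y‖ - η) (by rw [hD]; linarith)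
    refine ⟨z, hz.le, ?_⟩
    simpa [sub_eq_add_neg] using h
  wlog hgz : 0 ≤ g z generalizing z
  · refine this (-z) (by rwa [norm_neg]) ?_ (by rw [map_neg]; linarith)
    rwa [map_neg, neg_smul, ← neg_sub', norm_neg]
  have h1 : g z ≤ 1 := by
    have := (le_abs_self _).trans (g.le_opNorm_of_le hz)
    rwa [hg1, one_mul] at this
  have h2 : ‖z - g z • y‖ ≤ ‖z‖ + g z * ‖y‖ := by
    refine (norm_sub_le _ _).trans_eq ?_
    rw [norm_smul, Real.norm_of_nonneg hgz]
  have h3 : ‖z - g z • y‖ ≤ ‖z - y‖ + (1 - g z) * ‖y‖ := by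
    have : z - g z • y = (z - y) + (1 - g z) • y := by module
    rw [this]
    refine (norm_add_le _ _).trans_eq ?_
    rw [norm_smul, Real.norm_of_nonneg (by linarith)]
  have h4 : (1 - g z) * ‖y‖ ≤ η := by linarith
  refine ⟨z, hz, ?_, by linarith⟩
  have h5 : f z = ‖f‖ * g z := by
    rw [hg, smul_apply, smul_eq_mul, mul_inv_cancel_left₀ hf0.ne']
  have h6 : ‖f‖ * (1 - g z) ≤ ε := by
    refine le_of_mul_le_mul_right ?_ hy0
    calc ‖f‖ * (1 - g z) * ‖y‖ = ‖f‖ * ((1 - g z) * ‖y‖) := by ring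
      _ ≤ ‖f‖ * η := by gcongr
      _ ≤ ε * ‖y‖ := by linarith
  linarith

section EuclideanImage

variable {E : Type*} [NormedAddCommGroup E] [InnerProductSpace ℝ E]

/-- The vectors of `E` which are approximated, for every `y`, by images under `R` of points of
the unit ball of `Y` almost diametrically opposite to `y`. -/
def oppositeImage (R : Y →L[ℝ] E) : Set E :=
  {k | ∀ (y : Y) (ε : ℝ), 0 < ε → ∃ z : Y, ‖z‖ ≤ 1 ∧ ‖R z - k‖ ≤ ε ∧ ‖y‖ + 1 - ε ≤ ‖z - y‖}

theorem isClosed_oppositeImage (R : Y →L[ℝ] E) : IsClosed (oppositeImage R) := by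
  refine isClosed_of_closure_subset fun k hk y ε hε => ?_
  obtain ⟨k', hk', h⟩ := Metric.mem_closure_iff.1 hk (ε / 2) (half_pos hε)
  obtain ⟨z, hz, h1, h2⟩ := hk' y (ε / 2) (half_pos hε)
  refine ⟨z, hz, ?_, by linarith⟩
  rw [dist_eq_norm, norm_sub_rev] at h
  have := norm_sub_le_norm_sub_add_norm_sub (R z) k' k
  linarith

/-- Convexity comes from choosing the two points one after the other, the second one almost
opposite to `y` minus the multiple of the first. -/
theorem convex_oppositeImage (R : Y →L[ℝ] E) : Convex ℝ (oppositeImage R) := by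
  rw [convex_iff_forall_pos]
  intro k₁ hk₁ k₂ hk₂ a b ha hb hab y ε hε
  obtain ⟨z₁, hz₁, hR₁, hy₁⟩ := hk₁ (a⁻¹ • y) ε hε
  obtain ⟨z₂, hz₂, hR₂, hy₂⟩ := hk₂ (b⁻¹ • (y - a • z₁)) ε hε
  have h₁ : ‖y‖ + a - a * ε ≤ ‖y - a • z₁‖ := by
    have e1 : y - a • z₁ = (-a) • (z₁ - a⁻¹ • y) := by
      rw [smul_sub, smul_smul, neg_mul, mul_inv_cancel₀ ha.ne']; module
    rw [norm_smul, norm_inv, Real.norm_of_nonneg ha.le] at hy₁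
    rw [e1, norm_smul, norm_neg, Real.norm_of_nonneg ha.le]
    calc ‖y‖ + a - a * ε = a * (a⁻¹ * ‖y‖ + 1 - ε) := by field_simp
      _ ≤ _ := by gcongr
  have h₂ : ‖y - a • z₁‖ + b - b * ε ≤ ‖a • z₁ + b • z₂ - y‖ := by
    have e2 : a • z₁ + b • z₂ - y = b • (z₂ - b⁻¹ • (y - a • z₁)) := by
      rw [smul_sub, smul_smul, mul_inv_cancel₀ hb.ne']; module
    rw [norm_smul, norm_inv, Real.norm_of_nonneg hb.le] at hy₂
    rw [e2, norm_smul, Real.norm_of_nonneg hb.le]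
    calc ‖y - a • z₁‖ + b - b * ε = b * (b⁻¹ * ‖y - a • z₁‖ + 1 - ε) := by field_simp
      _ ≤ _ := by gcongr
  refine ⟨a • z₁ + b • z₂, ?_, ?_, ?_⟩
  · have := (convex_closedBall (0 : Y) 1) (mem_closedBall_zero_iff.2 hz₁)
      (mem_closedBall_zero_iff.2 hz₂) ha.le hb.le hab
    simpa using this
  · have := (convex_closedBall (0 : E) ε) (mem_closedBall_zero_iff.2 hR₁)
      (mem_closedBall_zero_iff.2 hR₂) ha.le hb.le hab
    rw [mem_closedBall_zero_iff] at this
    refine le_trans (le_of_eq ?_) this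
    rw [map_add, map_smul, map_smul]
    congr 1
    module
  · have : a * ε + b * ε = ε := by rw [← add_mul, hab, one_mul]
    linarith

/-- A point of the closure of the image of the unit ball which is at maximal distance from some
`c` has small slices as neighbourhoods, and these lift to slices of the unit ball. -/
theorem HasDaugavetProperty.farthest_mem_oppositeImage [Nontrivial Y]
    (hY : HasDaugavetProperty Y) (R : Y →L[ℝ] E) {k c : E}
    (hk : k ∈ closure (R '' Metric.closedBall 0 1))
    (hc : ∀ z : Y, ‖z‖ ≤ 1 → ‖R z - c‖ ≤ ‖k - c‖) : k ∈ oppositeImage R := by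
  intro y ε hε
  let f : StrongDual ℝ Y := (innerSL ℝ (k - c)).comp R
  have hf : ∀ z, f z = inner ℝ (k - c) (R z) := fun z => rfl
  have hkf : inner ℝ (k - c) k ≤ ‖f‖ := by
    have : closure (R '' Metric.closedBall 0 1) ⊆ {v | inner ℝ (k - c) v ≤ ‖f‖} := by
      refine closure_minimal ?_ (isClosed_le (by fun_prop) continuous_const)
      rintro _ ⟨z, hz, rfl⟩
      have := (le_abs_self _).trans (f.le_opNorm_of_le (mem_closedBall_zero_iff.1 hz))
      rwa [mul_one] at this
    exact this hk
  obtain ⟨δ, hδ, hδ1, hδ2⟩ : ∃ δ : ℝ, 0 < δ ∧ δ ≤ ε ∧ 2 * δ ≤ ε ^ 2 :=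
    ⟨min ε (ε ^ 2 / 2), by positivity, min_le_left _ _,
      by linarith [min_le_right ε (ε ^ 2 / 2)]⟩
  obtain ⟨z, hz, hfz, hzy⟩ := hY.exists_mem_slice f y hδ
  refine ⟨z, hz, ?_, by linarith⟩
  refine abs_le_of_sq_le_sq' ?_ hε.le |>.2
  have h1 : ‖R z - k‖ ^ 2 = ‖R z - c‖ ^ 2 - 2 * inner ℝ (k - c) (R z - c) + ‖k - c‖ ^ 2 := by
    rw [← sub_sub_sub_cancel_right (R z) k c, norm_sub_sq_real, real_inner_comm]
  have h2 : ‖R z - c‖ ^ 2 ≤ ‖k - c‖ ^ 2 := by gcongr; exact hc z hz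
  have h3 : inner ℝ (k - c) (R z - c) = f z - inner ℝ (k - c) k + ‖k - c‖ ^ 2 := by
    rw [hf, inner_sub_right, ← real_inner_self_eq_norm_sq, inner_sub_right (k - c) k c]
    ring
  nlinarith

/-- The image of the unit ball is contained in the closed convex hull of the points of its closure
that are farthest from some centre: a functional separating a point from this hull is
contradicted by centres far away in the direction opposite to it. -/
theorem HasDaugavetProperty.apply_mem_oppositeImage [Nontrivial Y] [FiniteDimensional ℝ E]
    (hY : HasDaugavetProperty Y) (R : Y →L[ℝ] E) {z₀ : Y} (hz₀ : ‖z₀‖ ≤ 1) :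
    R z₀ ∈ oppositeImage R := by
  by_contra hnot
  obtain ⟨f, u, hfu, hu⟩ := geometric_hahn_banach_closed_point (convex_oppositeImage R)
    (isClosed_oppositeImage R) hnot
  set w : E := (InnerProductSpace.toDual ℝ E).symm f
  have hw : ∀ v, inner ℝ w v = f v := fun v => InnerProductSpace.toDual_symm_apply
  set K := closure (R '' Metric.closedBall 0 1)
  have hKcomp : IsCompact K := by
    refine Metric.isCompact_of_isClosed_isBounded isClosed_closure (Bornology.IsBounded.closure ?_)
    exact R.lipschitz.isBounded_image Metric.isBounded_closedBall
  have hKne : K.Nonempty := ⟨R z₀, subset_closure ⟨z₀, by simpa using hz₀, rfl⟩⟩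
  -- The centre is moved to infinity in the direction `-w`.
  obtain ⟨N, hN⟩ := exists_nat_gt (‖R‖ ^ 2 / (2 * (f (R z₀) - u)))
  rw [div_lt_iff₀ (by linarith)] at hN
  obtain ⟨k, hk, hmax⟩ := hKcomp.exists_isMaxOn hKne
    (f := fun v => ‖v - (-(N : ℝ)) • w‖) (by fun_prop)
  have hfar : ∀ z : Y, ‖z‖ ≤ 1 → ‖R z - (-(N : ℝ)) • w‖ ≤ ‖k - (-(N : ℝ)) • w‖ :=
    fun z hz => hmax (subset_closure ⟨z, by simpa using hz, rfl⟩)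
  have hfk := hfu k (hY.farthest_mem_oppositeImage R hk hfar)
  have hkR : ‖k‖ ≤ ‖R‖ := by
    have : K ⊆ Metric.closedBall 0 ‖R‖ := by
      refine closure_minimal ?_ Metric.isClosed_closedBall
      rintro _ ⟨z, hz, rfl⟩
      simpa using R.le_opNorm_of_le (mem_closedBall_zero_iff.1 hz)
    exact mem_closedBall_zero_iff.1 (this hk)
  have hexp : ∀ v, ‖v - (-(N : ℝ)) • w‖ ^ 2 = ‖v‖ ^ 2 + 2 * N * f v + ‖(N : ℝ) • w‖ ^ 2 := by
    intro v
    rw [neg_smul, sub_neg_eq_add, norm_add_sq_real, inner_smul_right, real_inner_comm, hw]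
    ring
  have hsq := pow_le_pow_left₀ (norm_nonneg _) (hfar z₀ hz₀) 2
  rw [hexp, hexp] at hsq
  have h1 : ‖k‖ ^ 2 ≤ ‖R‖ ^ 2 := by gcongr
  have h2 : (N : ℝ) * f k ≤ N * u := by gcongr
  linarith [sq_nonneg ‖R z₀‖]

end EuclideanImage

/-- The inductive construction which shows that a space with the Daugavet property does not embed:
the `y` are alternating sums of points `z` of the unit ball and have arbitrarily large norms, while
their images are close to projections of the images of the `z`. -/
theorem HasDaugavetProperty.exists_norm_sub_proj_le [Nontrivial Y] (hY : HasDaugavetProperty Y)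
    (J : Y →L[ℝ] XT) (n : ℕ) {ε : ℝ} (hε : 0 < ε) :
    ∃ (y z : Y) (F : Finset Tree), ‖z‖ ≤ 1 ∧ n - ε ≤ ‖y‖ ∧ ‖J y - proj F (J z)‖ ≤ ε := by
  classical
  induction n generalizing ε with
  | zero => exact ⟨0, 0, ∅, by simp, by simp [hε.le], by simp [hε.le]⟩
  | succ n ih =>
    obtain ⟨y, z, F, hz, hy, hJ⟩ := ih (half_pos hε)
    let R : Y →L[ℝ] EuclideanSpace ℝ F :=
      ((EuclideanSpace.equiv F ℝ).symm : (F → ℝ) →L[ℝ] EuclideanSpace ℝ F).comp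
        (ContinuousLinearMap.pi fun t : F => (coord t.1).comp J)
    obtain ⟨η, hη, hη1, hη2⟩ : ∃ η : ℝ, 0 < η ∧ η ≤ ε / 2 ∧ F.card * η ≤ ε / 4 := by
      refine ⟨min (ε / 2) (ε / 4 / (F.card + 1)), by positivity, min_le_left _ _, ?_⟩
      calc (F.card : ℝ) * min (ε / 2) (ε / 4 / (F.card + 1))
          ≤ (F.card + 1) * (ε / 4 / (F.card + 1)) := by
            gcongr
            · linarith
            · exact min_le_right _ _
        _ = ε / 4 := by field_simp
    obtain ⟨z', hz', hR, hyz⟩ := hY.apply_mem_oppositeImage R hz y η hη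
    obtain ⟨F₀, hF₀⟩ := exists_norm_proj_sub_lt (J z') (show 0 < ε / 4 by positivity)
    have hcoord : ∀ t ∈ F, |coord t (J z' - J z)| ≤ η := by
      intro t ht
      refine le_trans (le_of_eq ?_) ((PiLp.norm_apply_le (R z' - R z) ⟨t, ht⟩).trans hR)
      rw [map_sub]
      rfl
    have hF : ‖proj F (J z') - proj F (J z)‖ ≤ ε / 4 := by
      rw [← map_sub, proj_apply]
      obtain ⟨G, hGF, -, h⟩ := exists_isChain_norm_eq F fun t => coord t (J z' - J z)
      rw [h]
      calc ∑ t ∈ G, |coord t (J z' - J z)| ≤ ∑ t ∈ F, |coord t (J z' - J z)| :=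
            Finset.sum_le_sum_of_subset_of_nonneg hGF fun _ _ _ => abs_nonneg _
        _ ≤ F.card * η := by
            rw [← nsmul_eq_mul]
            exact Finset.sum_le_card_nsmul _ _ _ hcoord
        _ ≤ ε / 4 := hη2
    have hsdiff : proj ((F₀ ∪ F) \ F) (J z') = proj (F₀ ∪ F) (J z') - proj F (J z') := by
      rw [eq_sub_iff_add_eq]
      simp only [proj_apply]
      exact Finset.sum_sdiff Finset.subset_union_right
    refine ⟨z' - y, z', (F₀ ∪ F) \ F, hz', by push_cast; linarith, ?_⟩
    have h0 := hF₀ (F₀ ∪ F) Finset.subset_union_left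
    have hdecomp : J (z' - y) - proj ((F₀ ∪ F) \ F) (J z') =
        (proj F (J z') - proj F (J z)) - (proj (F₀ ∪ F) (J z') - J z')
          - (J y - proj F (J z)) := by
      rw [hsdiff, map_sub]
      abel
    rw [hdecomp]
    have h1 := norm_sub_le (proj F (J z') - proj F (J z) - (proj (F₀ ∪ F) (J z') - J z'))
      (J y - proj F (J z))
    have h2 := norm_sub_le (proj F (J z') - proj F (J z)) (proj (F₀ ∪ F) (J z') - J z')
    linarith

theorem HasDaugavetProperty.not_exists_equiv_submodule [Nontrivial Y]
    (hY : HasDaugavetProperty Y) : ¬ ∃ Z : Submodule ℝ XT, Nonempty (Y ≃L[ℝ] Z) := by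
  rintro ⟨Z, ⟨φ⟩⟩
  let J : Y →L[ℝ] XT := Z.subtypeL.comp (φ : Y →L[ℝ] Z)
  set C := ‖(φ.symm : Z →L[ℝ] Y)‖
  have hlow : ∀ y, ‖y‖ ≤ C * ‖J y‖ := fun y => by
    have h := (φ.symm : Z →L[ℝ] Y).le_opNorm (φ y)
    rwa [ContinuousLinearEquiv.coe_coe, φ.symm_apply_apply] at h
  obtain ⟨n, hn⟩ := exists_nat_gt (C * (‖J‖ + 1) + 1)
  obtain ⟨y, z, F, hz, hy, hJ⟩ := hY.exists_norm_sub_proj_le J n one_pos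
  have h1 : ‖J y‖ ≤ ‖J‖ + 1 := by
    have h2 := norm_le_norm_add_norm_sub' (J y) (proj F (J z))
    have h3 := (norm_proj_le F (J z)).trans (J.le_opNorm_of_le hz)
    linarith
  have h4 : C * ‖J y‖ ≤ C * (‖J‖ + 1) := by gcongr
  linarith [hlow y]

end Daugavet

end BinaryTreeSpace

end

theorem theorem1p1 :
    -- the canonical vectors are a 1-unconditional basis of the (separable) binary tree space
    (∃ b : UnconditionalSchauderBasis BinaryTreeSpace.Tree ℝ BinaryTreeSpace.XT,
      (∀ t, b t = BinaryTreeSpace.e t) ∧ BinaryTreeSpace.IsUnconditionalWith b 1) ∧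
    TopologicalSpace.SeparableSpace BinaryTreeSpace.XT ∧
    -- the positive unit ball is not an SCD set
    ¬ BinaryTreeSpace.IsSCDSet BinaryTreeSpace.posBall ∧
    -- the positive unit ball is a Daugavet set
    BinaryTreeSpace.IsDaugavetSet BinaryTreeSpace.posBall ∧
    -- exact equality for finitely supported elements of the positive unit sphere
    (∀ x ∈ BinaryTreeSpace.posSphere, {t | BinaryTreeSpace.coord t x ≠ 0}.Finite →
      ∀ S : Set BinaryTreeSpace.XT, BinaryTreeSpace.IsSlice BinaryTreeSpace.posBall S →
        ∃ y ∈ S, ‖x + y‖ = 2) ∧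
    -- the binary tree space is not an SCD space
    ¬ BinaryTreeSpace.IsSCDSpace BinaryTreeSpace.XT ∧
    -- it contains no isomorphic copy of a (non-zero) Banach space with the Daugavet property
    (∀ (Y : Type*) [NormedAddCommGroup Y] [NormedSpace ℝ Y] [CompleteSpace Y] [Nontrivial Y],
      BinaryTreeSpace.HasDaugavetProperty Y →
        ¬ ∃ Z : Submodule ℝ BinaryTreeSpace.XT, Nonempty (Y ≃L[ℝ] Z)) := by
  open BinaryTreeSpace in
  exact ⟨⟨canonicalBasis, fun _ => rfl, isUnconditionalWith_canonicalBasis⟩, separableSpace,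
    posBall_not_isSCDSet, isDaugavetSet_posBall,
    fun _ hx hfin _ hS => exists_norm_add_eq_two hx hfin hS, not_isSCDSpace,
    fun _ _ _ _ _ hY => hY.not_exists_equiv_submodule⟩
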